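/- Let $p$ be a prime and let $G$ be a finite nilpotent group with commutator subgroup $G'$. Write $\zeta(R)$ for the centre of a ring $R$ and $\mathrm{nr} : M_n(\mathbb{Q}_p[G]) \to \zeta(\mathbb{Q}_p[G])$ $(n \geq 1)$ for the reduced norm, which is defined componentwise: if $\mathbb{Q}_p[G] = A_1 \oplus \cdots \oplus A_t$ is the decomposition into simple algebras and $F_i = \zeta(A_i)$, then the $i$-th component of $\mathrm{nr}$ in $\zeta(\mathbb{Q}_p[G]) = F_1 \oplus \cdots \oplus F_t$ is the reduced norm of the central simple $F_i$-algebra $M_n(A_i)$. Let $$\mathcal{I}_p(G) := \langle \mathrm{nr}(H) \mid H \in M_n(\mathbb{Z}_p[G]),\ n \geq 1 \rangle_{\zeta(\mathbb{Z}_p[G])} \subseteq \zeta(\mathbb{Q}_p[G])$$ be the $\zeta(\mathbb{Z}_p[G])$-submodule of $\zeta(\mathbb{Q}_p[G])$ generated by the reduced norms of all square matrices with entries in $\mathbb{Z}_p[G]$. Then $\mathcal{I}_p(G) = \zeta(\mathbb{Z}_p[G])$ if and only if $p$ does not divide $|G'|$. -/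

import Mathlib

noncomputable section

/-- A matrix representation `ρ : A → M_d(Fᵃ)` of an `F`-algebra `A` over an algebraic closure `Fᵃ`
of `F` is *splitting* if its image spans `M_d(Fᵃ)` over `Fᵃ`.

When `A = A₁ ⊕ ⋯ ⊕ A_t` is finite-dimensional and separable over `F`, with simple components `A_i`
and `F_i = ζ(A_i)`, such a `ρ` (for `d ≠ 0`) is nonzero on exactly one `A_i`, it embeds `F_i` into
`Fᵃ` (as scalar matrices), and it induces an isomorphism `Fᵃ ⊗_{F_i} A_i ≃ M_d(Fᵃ)`; every such
splitting of a component arises in this way. -/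
def IsSplitting (F : Type*) {A : Type*} [Field F] [Ring A] [Algebra F A] {d : ℕ}
    (ρ : A →ₐ[F] Matrix (Fin d) (Fin d) (AlgebraicClosure F)) : Prop :=
  Submodule.span (AlgebraicClosure F) (Set.range ρ) = ⊤

/-- `z` is a reduced norm of `H ∈ M_n(A)`: it lies in the centre of `A`, and in every splitting
`ρ` of a simple component of `A` it becomes the scalar matrix whose entry is the determinant of
`ρ(H)`, where `ρ(H)` is `H` with `ρ` applied to its entries, read as an `nd × nd` matrix. -/
def IsReducedNorm (F : Type*) {A : Type*} [Field F] [Ring A] [Algebra F A] {n : ℕ}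
    (H : Matrix (Fin n) (Fin n) A) (z : A) : Prop :=
  z ∈ Subalgebra.center F A ∧
    ∀ (d : ℕ) (ρ : A →ₐ[F] Matrix (Fin d) (Fin d) (AlgebraicClosure F)), IsSplitting F ρ →
      ρ z = Matrix.scalar (Fin d)
        (Matrix.comp (Fin n) (Fin n) (Fin d) (Fin d) (AlgebraicClosure F) (H.map ρ)).det

open Classical in
/-- The reduced norm `nr_A : M_n(A) → ζ(A)` of a finite-dimensional separable `F`-algebra `A`
(for such an algebra `z` exists and is unique; the value `0` is a default in all other cases). -/
def reducedNorm (F : Type*) {A : Type*} [Field F] [Ring A] [Algebra F A] {n : ℕ}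
    (H : Matrix (Fin n) (Fin n) A) : A :=
  if h : ∃ z, IsReducedNorm F H z then h.choose else 0

/-- The centre `ζ(Λ)` of an `O`-subalgebra `Λ` of `A`, as a subalgebra of `A`. -/
def orderCenter {O A : Type*} [CommRing O] [Ring A] [Algebra O A] (Λ : Subalgebra O A) :
    Subalgebra O A :=
  (Subalgebra.center O Λ).map Λ.val

/-- The integrality ring `I(Λ)` of an `O`-order `Λ` in a finite-dimensional separable `F`-algebra
`A`: the `ζ(Λ)`-submodule of `A` generated by the reduced norms `nr(H)` of all
`H ∈ M_n(Λ)`, `n ≥ 1`. -/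
def integralityRing (F : Type*) {O A : Type*} [Field F] [CommRing O] [Ring A] [Algebra F A]
    [Algebra O A] (Λ : Subalgebra O A) : Submodule (orderCenter Λ) A :=
  Submodule.span (orderCenter Λ)
    {z : A | ∃ (n : ℕ) (_ : 1 ≤ n) (H : Matrix (Fin n) (Fin n) Λ),
      z = reducedNorm F (H.map Λ.val)}

/-- The order `ℤ_p[G]` in the `ℚ_p`-algebra `ℚ_p[G]`. -/
def padicGroupRing (p : ℕ) [Fact p.Prime] (G : Type*) [Group G] :
    Subalgebra ℤ_[p] (MonoidAlgebra ℚ_[p] G) :=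
  (MonoidAlgebra.mapAlgHom G (Algebra.ofId ℤ_[p] ℚ_[p])).range

end

/-! Write `K` for an algebraic closure of `ℚ_[p]`. Since `K[G]` is a product of matrix algebras, a
central element is pinned down by its images under the surjections `K[G] → M_d(K)`. Prescribing
determinants there gives reduced norms over `K`; Galois descent brings them back to `ℚ_[p]`. As `1`
is a reduced norm, the theorem asks when all reduced norms have coefficients in `ℤ_[p]`
(`integralityRing_eq_orderCenter_iff`).

Integrality forces `p ∤ |G'|`: let `z = nr(g)` and let `P` be a Sylow `p`-subgroup. Passing to the
abelianization shows that the coefficients of `z` on the coset `gG'` sum to `1`. They are integral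
and constant on `P`-conjugacy orbits, so `p ∤ 1` yields a point of `gG'` fixed by `P`. Thus
`C_G(P)G' = G`, nilpotency gives `C_G(P) = G`, and transfer into the central subgroup `P` kills `G'`
with kernel of order prime to `p`.

Conversely, if `p ∤ |G'|` then `[P, G] ≤ P ∩ G' = 1`, and transfer splits `G` as `Q × P` with `p ∤
|Q|`. Over a valuation ring `R` of `K` dominating `ℤ_[p]`, the irreducible representations and
central idempotents `ε_j` of `Q` are defined over `R` (`exists_integral_wedderburn`). Hence `nr(H) =
∑ det(σ_j(H)) ε_j` with determinants in `R[P]`, and `R ∩ ℚ_[p] = ℤ_[p]`. -/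

/-! ### Matrix algebras and split semisimple algebras -/

/-- Every isomorphism between matrix algebras over a field is given by conjugation. -/
theorem exists_conj_of_matrix_algEquiv {K : Type*} [Field K] {a b : ℕ}
    (ψ : Matrix (Fin a) (Fin a) K ≃ₐ[K] Matrix (Fin b) (Fin b) K) :
    ∃ (U : Matrix (Fin b) (Fin a) K) (V : Matrix (Fin a) (Fin b) K),
      U * V = 1 ∧ V * U = 1 ∧ ∀ X, ψ X = U * X * V := by
  obtain ⟨T, hT⟩ := AlgEquiv.eq_linearEquivConjAlgEquiv
    ((Matrix.toLinAlgEquiv'.symm.trans ψ).trans Matrix.toLinAlgEquiv')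
  refine ⟨LinearMap.toMatrix' (T : (Fin a → K) →ₗ[K] (Fin b → K)),
    LinearMap.toMatrix' (T.symm : (Fin b → K) →ₗ[K] (Fin a → K)), ?_, ?_, fun X => ?_⟩
  · rw [← LinearMap.toMatrix'_comp]; simp
  · rw [← LinearMap.toMatrix'_comp]; simp
  · have h := congrArg (fun f => f (Matrix.toLinAlgEquiv' X)) hT
    simp only [AlgEquiv.trans_apply, AlgEquiv.symm_apply_apply, LinearEquiv.conjAlgEquiv_apply] at h
    apply Matrix.toLinAlgEquiv'.injective
    rw [h]
    apply LinearMap.toMatrix'.injective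
    change _ = LinearMap.toMatrix' (Matrix.toLin' _)
    rw [LinearMap.toMatrix'_comp, LinearMap.toMatrix'_comp, LinearMap.toMatrix'_toLin']
    rw [Matrix.mul_assoc]
    congr 2
    exact LinearMap.toMatrix'_toLin' X

theorem eq_of_matrix_algEquiv {K : Type*} [Field K] {a b : ℕ}
    (ψ : Matrix (Fin a) (Fin a) K ≃ₐ[K] Matrix (Fin b) (Fin b) K) : a = b := by
  have h := ψ.toLinearEquiv.finrank_eq
  simp only [Module.finrank_matrix, Fintype.card_fin, Module.finrank_self, mul_one] at h
  exact Nat.mul_self_inj.mp h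

/-- The determinant of a matrix of matrices, read as a block matrix. -/
abbrev blockDet {R : Type*} [CommRing R] {n d : ℕ}
    (X : Matrix (Fin n) (Fin n) (Matrix (Fin d) (Fin d) R)) : R :=
  (Matrix.comp (Fin n) (Fin n) (Fin d) (Fin d) R X).det

theorem blockDet_map {R S : Type*} [CommRing R] [CommRing S] (f : R →+* S) {n d : ℕ}
    (X : Matrix (Fin n) (Fin n) (Matrix (Fin d) (Fin d) R)) :
    blockDet (X.map fun M => M.map f) = f (blockDet X) := by
  rw [blockDet, Matrix.comp_map_map, blockDet, RingHom.map_det, RingHom.mapMatrix_apply]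

/-- By Skolem–Noether `ψ` is conjugation by some `U`, so the block matrix is conjugated by the block
diagonal matrix with blocks `U`. -/
theorem blockDet_algEquiv {K : Type*} [Field K] {n a b : ℕ}
    (ψ : Matrix (Fin a) (Fin a) K ≃ₐ[K] Matrix (Fin b) (Fin b) K)
    (X : Matrix (Fin n) (Fin n) (Matrix (Fin a) (Fin a) K)) :
    blockDet (X.map ψ) = blockDet X := by
  obtain rfl := eq_of_matrix_algEquiv ψ
  obtain ⟨U, V, hUV, -, h⟩ := exists_conj_of_matrix_algEquiv ψ
  have e : X.map ψ = Matrix.diagonal (fun _ => U) * X * Matrix.diagonal (fun _ => V) := by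
    ext1 i j
    simp [Matrix.diagonal_mul, Matrix.mul_diagonal, h]
  have e1 : (Matrix.diagonal (fun _ : Fin n => U)) * (Matrix.diagonal (fun _ : Fin n => V)) = 1 := by
    simp [Matrix.diagonal_mul_diagonal, hUV]
  have e2 := congrArg (fun Y => (Matrix.compRingEquiv (Fin n) (Fin a) K Y).det) e1
  simp only [map_mul, map_one, Matrix.det_mul, Matrix.det_one, Matrix.compRingEquiv_apply] at e2
  have e3 := congrArg (fun Y => (Matrix.compRingEquiv (Fin n) (Fin a) K Y).det) e
  simp only [map_mul, Matrix.det_mul, Matrix.compRingEquiv_apply] at e3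
  rw [blockDet, e3, mul_right_comm, e2, one_mul]

/-- A surjection from a product of matrix algebras onto a matrix algebra factors through
one of the components. -/
theorem exists_component_of_surjective {K B : Type*} [Field K] [Ring B] [Algebra K B] {ι : Type*}
    [Fintype ι] [DecidableEq ι] {m : ι → ℕ} (hm : ∀ i, NeZero (m i))
    (Φ : B ≃ₐ[K] ∀ i, Matrix (Fin (m i)) (Fin (m i)) K) {d : ℕ} (hd : d ≠ 0)
    (τ : B →ₐ[K] Matrix (Fin d) (Fin d) K) (hτ : Function.Surjective τ) :
    ∃ (i : ι) (ψ : Matrix (Fin (m i)) (Fin (m i)) K ≃ₐ[K] Matrix (Fin d) (Fin d) K),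
      ∀ x, τ x = ψ (Φ x i) := by
  have : NeZero d := ⟨hd⟩
  set σ : (∀ i, Matrix (Fin (m i)) (Fin (m i)) K) →ₐ[K] Matrix (Fin d) (Fin d) K :=
    τ.comp Φ.symm.toAlgHom with hσ
  have hσs : Function.Surjective σ := hτ.comp Φ.symm.surjective
  have hστ (x : B) : τ x = σ (Φ x) := by simp [hσ]
  have hcomm (i : ι) (x) : σ (Pi.single i 1) * σ x = σ x * σ (Pi.single i 1) := by
    rw [← map_mul, ← map_mul]
    congr 1
    ext1 j
    by_cases h : j = i
    · subst h; simp
    · simp [h]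
  -- The image of a central idempotent under a surjection is a central idempotent, hence a scalar
  -- `0` or `1`.
  have hsc (i : ι) : σ (Pi.single i 1) = 0 ∨ σ (Pi.single i 1) = 1 := by
    have h1 : σ (Pi.single i 1) ∈ Set.center (Matrix (Fin d) (Fin d) K) := by
      rw [Semigroup.mem_center_iff]
      intro y
      obtain ⟨x, rfl⟩ := hσs y
      exact (hcomm i x).symm
    rw [Matrix.center_eq_range] at h1
    obtain ⟨c, hc⟩ := h1
    have h2 : σ (Pi.single i 1) * σ (Pi.single i 1) = σ (Pi.single i 1) := by
      rw [← map_mul, ← Pi.single_mul, one_mul]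
    rw [← hc, ← map_mul, (Matrix.scalar_inj (n := Fin d))] at h2
    rcases IsIdempotentElem.iff_eq_zero_or_one.mp h2 with h | h
    all_goals simp [← hc, h]
  obtain ⟨i, hi⟩ : ∃ i, σ (Pi.single i 1) = 1 := by
    by_contra! h
    have h0 (i) : σ (Pi.single i 1) = 0 := (hsc i).resolve_right (h i)
    have h1 : (1 : ∀ i, Matrix (Fin (m i)) (Fin (m i)) K) = ∑ i, Pi.single i 1 :=
      (Finset.univ_sum_single (1 : ∀ i, Matrix (Fin (m i)) (Fin (m i)) K)).symm
    have h2 := congrArg σ h1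
    rw [map_sum, map_one, Finset.sum_eq_zero fun i _ => h0 i] at h2
    exact one_ne_zero h2
  have hval (x) : σ x = σ (Pi.single i (x i)) := by
    have : x * Pi.single i 1 = Pi.single i (x i) := by
      ext1 j
      by_cases h : j = i
      · subst h; simp
      · simp [h]
    rw [← this, map_mul, hi, mul_one]
  let ψ₀ : Matrix (Fin (m i)) (Fin (m i)) K →ₐ[K] Matrix (Fin d) (Fin d) K :=
    { toFun := fun y => σ (Pi.single i y)
      map_one' := hi
      map_mul' := fun x y => by rw [← map_mul, Pi.single_mul]
      map_zero' := by simp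
      map_add' := fun x y => by rw [← map_add, Pi.single_add]
      commutes' := fun r => by
        rw [← AlgHom.commutes σ r, hval (algebraMap K _ r)]; rfl }
  have hψ : Function.Bijective ψ₀ := by
    constructor
    · have := hm i
      exact ψ₀.toRingHom.injective
    · intro y
      obtain ⟨x, rfl⟩ := hσs y
      exact ⟨x i, (hval x).symm⟩
  exact ⟨i, AlgEquiv.ofBijective ψ₀ hψ, fun x => by rw [hστ, hval]; rfl⟩

/-- Surjections onto matrix algebras separate the points of a finite-dimensional semisimple
algebra over an algebraically closed field. -/
theorem eq_of_forall_surjective {K B : Type*} [Field K] [IsAlgClosed K] [Ring B] [Algebra K B]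
    [IsSemisimpleRing B] [FiniteDimensional K B] {x y : B}
    (h : ∀ (d : ℕ) (τ : B →ₐ[K] Matrix (Fin d) (Fin d) K), Function.Surjective τ → τ x = τ y) :
    x = y := by
  obtain ⟨k, m, hm, ⟨Φ⟩⟩ := IsSemisimpleRing.exists_algEquiv_pi_matrix_of_isAlgClosed K B
  apply Φ.injective
  ext1 i
  refine h (m i) ((Pi.evalAlgHom K (fun i => Matrix (Fin (m i)) (Fin (m i)) K) i).comp
    (Φ : B →ₐ[K] _)) ?_
  exact (Function.surjective_eval i).comp Φ.surjective

/-- In a finite-dimensional semisimple algebra over an algebraically closed field, there is a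
central element whose image under each surjection onto a matrix algebra is the determinant of
the image of `H`. -/
theorem exists_blockDet_lift {K B : Type*} [Field K] [IsAlgClosed K] [Ring B] [Algebra K B]
    [IsSemisimpleRing B] [FiniteDimensional K B] {n : ℕ} (H : Matrix (Fin n) (Fin n) B) :
    ∃ w ∈ Set.center B, ∀ (d : ℕ) (τ : B →ₐ[K] Matrix (Fin d) (Fin d) K), Function.Surjective τ →
      τ w = Matrix.scalar (Fin d) (blockDet (H.map τ)) := by
  obtain ⟨k, m, hm, ⟨Φ⟩⟩ := IsSemisimpleRing.exists_algEquiv_pi_matrix_of_isAlgClosed K B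
  refine ⟨Φ.symm fun i => Matrix.scalar _ (blockDet (H.map fun b => Φ b i)), ?_, ?_⟩
  · rw [Semigroup.mem_center_iff]
    intro b
    apply Φ.injective
    rw [map_mul, map_mul, Φ.apply_symm_apply]
    ext1 i
    exact ((Matrix.scalar_commute _ (fun _ => Commute.all _ _) _).eq).symm
  · intro d τ hτ
    -- Surjections onto the zero ring `M_0(K)` are allowed, but select no component.
    rcases eq_or_ne d 0 with rfl | hd
    · exact Subsingleton.elim _ _
    obtain ⟨i, ψ, h⟩ := exists_component_of_surjective hm Φ hd τ hτ
    have e : H.map τ = (H.map fun b => Φ b i).map ψ := by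
      ext1 a b
      simp [h]
    rw [h, Φ.apply_symm_apply, e, blockDet_algEquiv]
    exact ψ.commutes _

/-! ### Existence, uniqueness and functoriality of reduced norms -/

section Descent

variable (F : Type*) [Field F] (G : Type*) [Group G]

/-- Extension of scalars `F[G] → Fᵃ[G]`. -/
noncomputable abbrev extendScalars : MonoidAlgebra F G →ₐ[F] MonoidAlgebra (AlgebraicClosure F) G :=
  MonoidAlgebra.mapAlgHom G (Algebra.ofId F (AlgebraicClosure F))

variable {F G}

theorem extendScalars_injective : Function.Injective (extendScalars F G) := by
  intro x y h
  ext g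
  have := congrArg (fun z => z.coeff g) h
  simp only [MonoidAlgebra.coeff_mapAlgHom] at this
  exact (algebraMap F (AlgebraicClosure F)).injective this

theorem exists_lift_of_isSplitting {d : ℕ}
    (ρ : MonoidAlgebra F G →ₐ[F] Matrix (Fin d) (Fin d) (AlgebraicClosure F))
    (hρ : IsSplitting F ρ) :
    ∃ τ : MonoidAlgebra (AlgebraicClosure F) G →ₐ[AlgebraicClosure F]
        Matrix (Fin d) (Fin d) (AlgebraicClosure F),
      Function.Surjective τ ∧ ∀ x, τ (extendScalars F G x) = ρ x := by
  let τ := MonoidAlgebra.lift (AlgebraicClosure F) (Matrix (Fin d) (Fin d) (AlgebraicClosure F)) G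
    ((ρ : _ →* _).comp (MonoidAlgebra.of F G))
  have h (x) : τ (extendScalars F G x) = ρ x := by
    have : (τ.restrictScalars F).comp (extendScalars F G) = ρ := by
      apply MonoidAlgebra.algHom_ext
      · intro g
        simp [τ]
      · ext
    exact congrArg (fun f => f x) this
  refine ⟨τ, ?_, h⟩
  rw [IsSplitting] at hρ
  have hle : Submodule.span (AlgebraicClosure F) (Set.range ρ) ≤ LinearMap.range τ.toLinearMap :=
    Submodule.span_le.mpr fun _ ⟨x, hx⟩ => ⟨extendScalars F G x, (h x).trans hx⟩
  rw [hρ] at hle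
  exact fun M => hle (Submodule.mem_top (x := M))

theorem isSplitting_restrict {d : ℕ}
    (τ : MonoidAlgebra (AlgebraicClosure F) G →ₐ[AlgebraicClosure F]
      Matrix (Fin d) (Fin d) (AlgebraicClosure F)) (hτ : Function.Surjective τ) :
    IsSplitting F ((τ.restrictScalars F).comp (extendScalars F G)) := by
  rw [IsSplitting, eq_top_iff]
  intro M _
  obtain ⟨x, rfl⟩ := hτ M
  induction x using MonoidAlgebra.induction_on with
  | of g =>
    refine Submodule.subset_span ⟨MonoidAlgebra.of F G g, ?_⟩
    simp
  | add x y hx hy => rw [map_add]; exact add_mem (hx trivial) (hy trivial)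
  | smul r x hx => rw [map_smul]; exact Submodule.smul_mem _ _ (hx trivial)

/-- Splittings of `F[G]` are exactly the restrictions of surjections from `Fᵃ[G]`, so reduced norms
can be tested over the closure. -/
theorem isReducedNorm_iff {n : ℕ} (H : Matrix (Fin n) (Fin n) (MonoidAlgebra F G))
    (z : MonoidAlgebra F G) :
    IsReducedNorm F H z ↔ z ∈ Set.center (MonoidAlgebra F G) ∧
      ∀ (d : ℕ) (τ : MonoidAlgebra (AlgebraicClosure F) G →ₐ[AlgebraicClosure F]
        Matrix (Fin d) (Fin d) (AlgebraicClosure F)), Function.Surjective τ →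
        τ (extendScalars F G z) =
          Matrix.scalar (Fin d) (blockDet ((H.map (extendScalars F G)).map τ)) := by
  refine and_congr Iff.rfl ⟨fun h d τ hτ => h d _ (isSplitting_restrict τ hτ), fun h d ρ hρ => ?_⟩
  obtain ⟨τ, hτ, e⟩ := exists_lift_of_isSplitting ρ hρ
  rw [← e, h d τ hτ]
  congr 2
  ext1 i j
  exact e _

/-- The twist of a matrix representation of `K[G]` by an automorphism of `K`. -/
theorem exists_algHom_twist {K : Type*} [Field K] (σ : K ≃+* K) {d : ℕ}
    (τ : MonoidAlgebra K G →ₐ[K] Matrix (Fin d) (Fin d) K) :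
    ∃ τ' : MonoidAlgebra K G →ₐ[K] Matrix (Fin d) (Fin d) K,
      ∀ x, τ (MonoidAlgebra.mapRingHom G (σ : K →+* K) x) = (τ' x).map σ := by
  let τ' : MonoidAlgebra K G →ₐ[K] Matrix (Fin d) (Fin d) K :=
    MonoidAlgebra.lift K (Matrix (Fin d) (Fin d) K) G
      (((σ.symm : K →+* K).mapMatrix (m := Fin d)).toMonoidHom.comp
        ((τ : _ →* _).comp (MonoidAlgebra.of K G)))
  refine ⟨τ', fun x => ?_⟩
  induction x using MonoidAlgebra.induction_on with
  | of g =>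
    ext i j
    simp [τ', MonoidAlgebra.mapRingHom]
  | add x y hx hy => rw [map_add, map_add, map_add, hx, hy, Matrix.map_add]; exact map_add σ
  | smul r x hx =>
    have e : MonoidAlgebra.mapRingHom G (σ : K →+* K) (r • x) =
        σ r • MonoidAlgebra.mapRingHom G (σ : K →+* K) x := by
      ext g; simp [MonoidAlgebra.mapRingHom]
    rw [e, map_smul, map_smul, hx]
    ext i j
    simp

variable [Finite G] [CharZero F]

theorem IsReducedNorm.eq {n : ℕ} {H : Matrix (Fin n) (Fin n) (MonoidAlgebra F G)}
    {z w : MonoidAlgebra F G} (hz : IsReducedNorm F H z) (hw : IsReducedNorm F H w) : z = w := by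
  rw [isReducedNorm_iff] at hz hw
  refine extendScalars_injective (eq_of_forall_surjective (K := AlgebraicClosure F) fun d τ hτ => ?_)
  rw [hz.2 d τ hτ, hw.2 d τ hτ]

/-- Reduced norms exist in group algebras of finite groups in characteristic zero. -/
theorem exists_isReducedNorm {n : ℕ} (H : Matrix (Fin n) (Fin n) (MonoidAlgebra F G)) :
    ∃ z, IsReducedNorm F H z := by
  obtain ⟨w, hwc, hw⟩ := exists_blockDet_lift (K := AlgebraicClosure F)
    (H.map (extendScalars F G))
  -- Twisting by `σ` permutes the surjections `τ`, and determinants commute with `σ`. So `w` and its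
  -- twist have the same image under every `τ`.
  have hfix (σ : AlgebraicClosure F ≃ₐ[F] AlgebraicClosure F) (g : G) :
      σ (w.coeff g) = w.coeff g := by
    have key : MonoidAlgebra.mapRingHom G (σ.toRingEquiv : AlgebraicClosure F →+* _) w = w := by
      refine eq_of_forall_surjective (K := AlgebraicClosure F) fun d τ hτ => ?_
      obtain ⟨τ', h⟩ := exists_algHom_twist σ.toRingEquiv τ
      have hτ' : Function.Surjective τ' := by
        intro M
        obtain ⟨y, hy⟩ := hτ (M.map σ)
        refine ⟨MonoidAlgebra.mapRingHom G (σ.symm.toRingEquiv : AlgebraicClosure F →+* _) y, ?_⟩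
        apply Matrix.map_injective σ.injective
        have := h (MonoidAlgebra.mapRingHom G (σ.symm.toRingEquiv : AlgebraicClosure F →+* _) y)
        refine this.symm.trans (Eq.trans ?_ hy)
        congr 1
        ext g
        simp [MonoidAlgebra.mapRingHom]
      rw [h, hw d τ hτ, hw d τ' hτ']
      have e : (H.map (extendScalars F G)).map τ =
          ((H.map (extendScalars F G)).map τ').map fun M =>
            M.map (σ.toRingEquiv : AlgebraicClosure F →+* _) := by
        ext1 i j
        refine Eq.trans ?_ (h _)
        simp only [Matrix.map_apply]
        congr 1
        ext g
        simp [MonoidAlgebra.mapRingHom, Algebra.ofId_apply]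
      rw [e, blockDet_map]
      ext i j
      by_cases hij : i = j
      · subst hij; simp
      · simp [hij]
    have := congrArg (fun x => x.coeff g) key
    simpa [MonoidAlgebra.mapRingHom] using this
  have hex (g : G) : ∃ c : F, algebraMap F (AlgebraicClosure F) c = w.coeff g := by
    have := (InfiniteGalois.mem_bot_iff_fixed (k := F) (w.coeff g)).mpr fun σ => hfix σ g
    exact IntermediateField.mem_bot.mp this
  choose c hc using hex
  have hz : extendScalars F G (.ofCoeff (Finsupp.equivFunOnFinite.symm c)) = w := by
    ext g
    simp [hc, Algebra.ofId_apply]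
  refine ⟨.ofCoeff (Finsupp.equivFunOnFinite.symm c), (isReducedNorm_iff _ _).mpr ⟨?_, ?_⟩⟩
  · rw [Semigroup.mem_center_iff] at hwc ⊢
    intro x
    apply extendScalars_injective
    rw [map_mul, map_mul, hz, hwc]
  · rwa [hz]

theorem reducedNorm_spec {n : ℕ} (H : Matrix (Fin n) (Fin n) (MonoidAlgebra F G)) :
    IsReducedNorm F H (reducedNorm F H) := by
  have h := exists_isReducedNorm H
  rw [reducedNorm, dif_pos h]
  exact h.choose_spec

theorem IsReducedNorm.reducedNorm_eq {n : ℕ} {H : Matrix (Fin n) (Fin n) (MonoidAlgebra F G)}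
    {z : MonoidAlgebra F G} (hz : IsReducedNorm F H z) : reducedNorm F H = z :=
  (reducedNorm_spec H).eq hz

theorem reducedNorm_one (n : ℕ) :
    reducedNorm F (1 : Matrix (Fin n) (Fin n) (MonoidAlgebra F G)) = 1 := by
  refine IsReducedNorm.reducedNorm_eq ((isReducedNorm_iff _ _).mpr ⟨Set.one_mem_center, ?_⟩)
  intro d τ _
  rw [Matrix.map_one _ (map_zero _) (map_one _), Matrix.map_one _ (map_zero _) (map_one _),
    blockDet, Matrix.comp_one, Matrix.det_one, map_one, map_one, map_one]

/-- Reduced norms are compatible with homomorphisms of groups that are surjective. -/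
theorem reducedNorm_mapDomain {G' : Type*} [Group G'] [Finite G'] (π : G →* G')
    (hπ : Function.Surjective π) {n : ℕ} (H : Matrix (Fin n) (Fin n) (MonoidAlgebra F G)) :
    reducedNorm F (H.map (MonoidAlgebra.mapDomainAlgHom F F π)) =
      MonoidAlgebra.mapDomainAlgHom F F π (reducedNorm F H) := by
  have hs : Function.Surjective (MonoidAlgebra.mapDomainAlgHom F F π) := by
    intro x
    induction x using MonoidAlgebra.induction_on with
    | of g =>
      obtain ⟨g, rfl⟩ := hπ g
      exact ⟨MonoidAlgebra.of F G g, by simp⟩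
    | add x y hx hy =>
      obtain ⟨x, rfl⟩ := hx
      obtain ⟨y, rfl⟩ := hy
      exact ⟨x + y, map_add _ _ _⟩
    | smul r x hx =>
      obtain ⟨x, rfl⟩ := hx
      exact ⟨r • x, map_smul _ _ _⟩
  obtain ⟨hc, h⟩ := reducedNorm_spec H
  refine IsReducedNorm.reducedNorm_eq ⟨?_, fun d ρ hρ => ?_⟩
  · rw [Subalgebra.mem_center_iff] at hc ⊢
    intro y
    obtain ⟨y, rfl⟩ := hs y
    rw [← map_mul, ← map_mul, hc]
  · refine h d (ρ.comp (MonoidAlgebra.mapDomainAlgHom F F π)) ?_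
    rw [IsSplitting] at hρ ⊢
    rw [← hρ]
    congr 1
    exact hs.range_comp ρ

end Descent

/-- Over a commutative group the reduced norm of a `1 × 1` matrix is its entry. -/
theorem reducedNorm_of_comm {F : Type*} [Field F] [CharZero F] {G : Type*} [CommGroup G] [Finite G]
    (x : MonoidAlgebra F G) :
    reducedNorm F (Matrix.of fun _ _ : Fin 1 => x) = x := by
  refine IsReducedNorm.reducedNorm_eq ((isReducedNorm_iff _ _).mpr
    ⟨Semigroup.mem_center_iff.mpr fun y => mul_comm _ _, fun d τ hτ => ?_⟩)
  -- A commutative algebra surjects onto `M_d` only for `d ≤ 1`; otherwise two matrix units would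
  -- commute.
  have hd : ∀ i j : Fin d, i = j := by
    intro i j
    by_contra hij
    obtain ⟨a, ha⟩ := hτ (Matrix.single i j 1)
    obtain ⟨b, hb⟩ := hτ (Matrix.single j i 1)
    have e : τ a * τ b = τ b * τ a := by rw [← map_mul, ← map_mul, mul_comm]
    rw [ha, hb, Matrix.single_mul_single_same, Matrix.single_mul_single_same] at e
    have := congrFun (congrFun e i) i
    simp [Ne.symm hij] at this
  ext i j
  obtain rfl := hd i j
  have : Subsingleton (Fin d) := ⟨hd⟩
  rw [blockDet, Matrix.det_eq_elem_of_subsingleton _ (0, i)]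
  · simp

/-! ### Fixed points, nilpotent groups and transfer -/

section GroupTheory

/-- If an invariant function on a finite set with an action of a `p`-group has a sum that is not
divisible by `p`, then it is nonzero at some fixed point. -/
theorem IsPGroup.exists_fixedPoint_of_not_dvd_sum {p : ℕ} [Fact p.Prime] {P : Type*} [Group P]
    (hP : IsPGroup p P) {X : Type*} [Fintype X] [MulAction P X] {R : Type*} [CommRing R]
    (f : X → R) (hf : ∀ (a : P) (x : X), f (a • x) = f x) (h : ¬ (p : R) ∣ ∑ x, f x) :
    ∃ x, f x ≠ 0 ∧ ∀ a : P, a • x = x := by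
  classical
  by_contra! hfix
  apply h
  -- Sum orbit by orbit: an orbit contributes its size, a power of `p`, times a constant value. Size
  -- `1` is excluded where that value is nonzero.
  rw [← Finset.sum_fiberwise Finset.univ
    (fun x => (Quotient.mk'' x : MulAction.orbitRel.Quotient P X)) f]
  refine Finset.dvd_sum fun ω _ => ?_
  induction ω using Quotient.inductionOn' with
  | h x =>
    have hconst : ∀ y ∈ Finset.univ.filter
        (fun y => (Quotient.mk'' y : MulAction.orbitRel.Quotient P X) = Quotient.mk'' x),
        f y = f x := by
      intro y hy
      obtain ⟨a, rfl⟩ := MulAction.orbitRel_apply.mp (Quotient.eq''.mp (Finset.mem_filter.mp hy).2)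
      exact hf a x
    rw [Finset.sum_congr rfl hconst, Finset.sum_const, nsmul_eq_mul]
    by_cases hx : f x = 0
    · simp [hx]
    refine Dvd.dvd.mul_right (Nat.cast_dvd_cast ?_) _
    have hcard : (Finset.univ.filter
        (fun y => (Quotient.mk'' y : MulAction.orbitRel.Quotient P X) = Quotient.mk'' x)).card
        = Nat.card (MulAction.orbit P x) := by
      rw [Nat.card_eq_fintype_card, ← Set.toFinset_card]
      congr 1
      ext y
      simp only [Finset.mem_filter, Finset.mem_univ, true_and, Set.mem_toFinset]
      rw [Quotient.eq'', MulAction.orbitRel_apply]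
    rw [hcard]
    obtain ⟨n, hn⟩ := hP.card_orbit x
    rw [hn]
    refine dvd_pow_self p ?_
    rintro rfl
    rw [pow_zero, Nat.card_eq_one_iff_unique] at hn
    obtain ⟨a, ha⟩ := hfix x hx
    have := hn.1
    exact ha (congrArg Subtype.val (Subsingleton.elim
      (⟨a • x, MulAction.mem_orbit x a⟩ : MulAction.orbit P x) ⟨x, MulAction.mem_orbit_self x⟩))

/-- A subgroup of a finite nilpotent group that generates it together with the commutator subgroup
is the whole group. -/
theorem eq_top_of_sup_commutator_eq_top {G : Type*} [Group G] [Finite G]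
    [Group.IsNilpotent G] {H : Subgroup G} (h : H ⊔ commutator G = ⊤) : H = ⊤ := by
  rcases eq_top_or_exists_le_coatom H with h0 | ⟨M, hM, hHM⟩
  · exact h0
  exfalso
  -- Maximal subgroups of a nilpotent group are normal. `G ⧸ M` is then nontrivial and solvable,
  -- hence not perfect, while `M ⊔ commutator G = ⊤` would make it perfect.
  have hn : M.Normal :=
    Subgroup.NormalizerCondition.normal_of_coatom M Group.normalizerCondition_of_isNilpotent hM
  have h1 : M ⊔ commutator G = ⊤ := top_le_iff.mp (h ▸ sup_le_sup_right hHM _)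
  have : Nontrivial (G ⧸ M) := QuotientGroup.nontrivial_iff.mpr hM.1
  have h2 := Group.IsSolvable.commutator_lt_top_of_nontrivial (G ⧸ M)
  refine h2.ne ?_
  have h3 : (commutator G).map (QuotientGroup.mk' M) = ⊤ := by
    have := congrArg (Subgroup.map (QuotientGroup.mk' M)) h1
    rw [Subgroup.map_sup, QuotientGroup.map_mk'_self, bot_sup_eq,
      Subgroup.map_top_of_surjective _ (QuotientGroup.mk'_surjective M)] at this
    exact this
  rw [eq_top_iff, ← h3, commutator_def, Subgroup.map_commutator]
  exact Subgroup.commutator_mono le_top le_top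

variable {G : Type*} [Group G] [Finite G] {p : ℕ} [Fact p.Prime]

/-- Transfer maps `G` to the commutative group `P`, so its kernel contains the commutator subgroup;
by Burnside that kernel has order prime to `p`. -/
theorem Sylow.not_dvd_card_commutator (P : Sylow p G) (hP : (P : Subgroup G) ≤ Subgroup.center G) :
    ¬ p ∣ Nat.card (commutator G) := by
  have hP' : Subgroup.normalizer (P : Set G) ≤ Subgroup.centralizer (P : Set G) := by
    intro g _ x hx
    exact (Subgroup.mem_center_iff.mp (hP hx) g).symm
  have hle : commutator G ≤ (MonoidHom.transferSylow P hP').ker := by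
    rw [commutator_def, Subgroup.commutator_le]
    intro a _ b _
    rw [MonoidHom.mem_ker, map_commutatorElement, commutatorElement_eq_one_iff_mul_comm]
    exact Subtype.ext (Subgroup.mem_center_iff.mp
      (hP (MonoidHom.transferSylow P hP' b).2) _)
  exact fun h => MonoidHom.not_dvd_card_ker_transferSylow P hP'
    (h.trans (Subgroup.card_dvd_of_le hle))

/-- `P` is normal because `G` is nilpotent, so `[P, G]` lies in both `P` and `G'`, which have
coprime orders. -/
theorem Sylow.le_center_of_not_dvd [Group.IsNilpotent G] (P : Sylow p G)
    (h : ¬ p ∣ Nat.card (commutator G)) : (P : Subgroup G) ≤ Subgroup.center G := by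
  have hbot : ⁅(P : Subgroup G), (⊤ : Subgroup G)⁆ = ⊥ := by
    rw [eq_bot_iff]
    have hcop : Nat.Coprime (Nat.card P) (Nat.card (commutator G)) := by
      obtain ⟨n, hn⟩ := IsPGroup.iff_card.mp P.isPGroup'
      rw [hn]
      exact ((Nat.Prime.coprime_iff_not_dvd Fact.out).mpr h).pow_left n
    rw [← (Subgroup.disjoint_of_coprime_natCard hcop).eq_bot]
    exact le_inf ((Subgroup.commutator_le_inf _ _).trans inf_le_left)
      (Subgroup.commutator_mono le_top le_rfl)
  rw [Subgroup.commutator_eq_bot_iff_le_centralizer] at hbot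
  intro x hx
  exact Subgroup.mem_center_iff.mpr fun g => Subgroup.mem_centralizer_iff.mp (hbot hx) g trivial

/-- A finite nilpotent group whose commutator subgroup has order prime to `p` is the product of a
group of order prime to `p` and a commutative group. -/
theorem exists_mulEquiv_prod_of_not_dvd [Group.IsNilpotent G] (h : ¬ p ∣ Nat.card (commutator G)) :
    ∃ Q P : Subgroup G, ¬ p ∣ Nat.card Q ∧ (∀ a b : P, a * b = b * a) ∧ Nonempty (G ≃* Q × P) := by
  let P : Sylow p G := default
  have hP := P.le_center_of_not_dvd h
  have hP' : Subgroup.normalizer (P : Set G) ≤ Subgroup.centralizer (P : Set G) := by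
    intro g _ x hx
    exact (Subgroup.mem_center_iff.mp (hP hx) g).symm
  refine ⟨(MonoidHom.transferSylow P hP').ker, P, MonoidHom.not_dvd_card_ker_transferSylow P hP',
    fun a b => Subtype.ext (Subgroup.mem_center_iff.mp (hP b.2) _), ⟨(MulEquiv.ofBijective
      (MonoidHom.noncommCoprod (MonoidHom.transferSylow P hP').ker.subtype (P : Subgroup G).subtype
        fun a b => Subgroup.mem_center_iff.mp (hP b.2) _) ?_).symm⟩⟩
  exact MonoidHom.ker_transferSylow_isComplement' P hP'

end GroupTheory

/-! ### Integrality of reduced norms makes Sylow subgroups central -/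

section PadicGroupRing

variable {p : ℕ} [Fact p.Prime] {G : Type*} [Group G]

theorem mem_padicGroupRing_iff_exists {x : MonoidAlgebra ℚ_[p] G} :
    x ∈ padicGroupRing p G ↔ ∃ y : MonoidAlgebra ℤ_[p] G, ∀ g, x.coeff g = y.coeff g := by
  constructor
  · rintro ⟨y, rfl⟩
    exact ⟨y, fun g => MonoidAlgebra.coeff_mapAlgHom _ _ _⟩
  · rintro ⟨y, hy⟩
    exact ⟨y, MonoidAlgebra.ext (Finsupp.ext fun g =>
      (MonoidAlgebra.coeff_mapAlgHom _ _ _).trans (hy g).symm)⟩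

theorem mem_padicGroupRing_of_norm_le [Finite G] {x : MonoidAlgebra ℚ_[p] G}
    (h : ∀ g, ‖x.coeff g‖ ≤ 1) : x ∈ padicGroupRing p G :=
  mem_padicGroupRing_iff_exists.mpr
    ⟨.ofCoeff (Finsupp.equivFunOnFinite.symm fun g => ⟨x.coeff g, h g⟩), fun _ => rfl⟩

theorem single_mem_padicGroupRing (g : G) :
    (MonoidAlgebra.single g 1 : MonoidAlgebra ℚ_[p] G) ∈ padicGroupRing p G :=
  ⟨MonoidAlgebra.single g 1, by simp⟩

theorem mem_orderCenter_of_mem_center {x : MonoidAlgebra ℚ_[p] G} (h : x ∈ padicGroupRing p G)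
    (hc : x ∈ Subalgebra.center ℚ_[p] (MonoidAlgebra ℚ_[p] G)) :
    x ∈ orderCenter (padicGroupRing p G) :=
  ⟨⟨x, h⟩, Subalgebra.mem_center_iff.mpr fun y =>
    Subtype.ext (Subalgebra.mem_center_iff.mp hc y), rfl⟩

theorem mem_padicGroupRing_of_mem_orderCenter {x : MonoidAlgebra ℚ_[p] G}
    (h : x ∈ orderCenter (padicGroupRing p G)) : x ∈ padicGroupRing p G := by
  obtain ⟨y, -, rfl⟩ := h
  exact y.2

/-- The integrality ring is the centre if and only if all reduced norms are integral. -/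
theorem integralityRing_eq_orderCenter_iff [Finite G] :
    (integralityRing ℚ_[p] (padicGroupRing p G) : Set (MonoidAlgebra ℚ_[p] G)) =
        (orderCenter (padicGroupRing p G) : Set (MonoidAlgebra ℚ_[p] G)) ↔
      ∀ (n : ℕ) (_ : 1 ≤ n) (H : Matrix (Fin n) (Fin n) (padicGroupRing p G)),
        reducedNorm ℚ_[p] (H.map (padicGroupRing p G).val) ∈ padicGroupRing p G := by
  constructor
  · intro h n hn H
    apply mem_padicGroupRing_of_mem_orderCenter
    rw [← SetLike.mem_coe, ← h]
    exact Submodule.subset_span ⟨n, hn, H, rfl⟩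
  · intro h
    apply Set.Subset.antisymm
    · intro x hx
      refine Submodule.span_induction (p := fun x _ => x ∈ orderCenter (padicGroupRing p G))
        ?_ (zero_mem _) (fun _ _ _ _ => add_mem)
        (fun (a : orderCenter (padicGroupRing p G)) _ _ hx => mul_mem a.2 hx) hx
      rintro _ ⟨n, hn, H, rfl⟩
      exact mem_orderCenter_of_mem_center (h n hn H) (reducedNorm_spec _).1
    · intro x hx
      have h1 : (1 : MonoidAlgebra ℚ_[p] G) ∈ integralityRing ℚ_[p] (padicGroupRing p G) := by
        refine Submodule.subset_span ⟨1, le_rfl, 1, ?_⟩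
        rw [Matrix.map_one _ (map_zero _) (map_one _), reducedNorm_one]
      have := Submodule.smul_mem _ (⟨x, hx⟩ : orderCenter (padicGroupRing p G)) h1
      rwa [Subalgebra.smul_def, smul_eq_mul, mul_one] at this

theorem coeff_conj_of_mem_center {F : Type*} [Field F] {z : MonoidAlgebra F G}
    (hz : z ∈ Subalgebra.center F (MonoidAlgebra F G)) (a g : G) :
    z.coeff (a * g * a⁻¹) = z.coeff g := by
  have h := Subalgebra.mem_center_iff.mp hz (MonoidAlgebra.single a 1)
  have := congrArg (fun x => x.coeff (a * g)) h
  simpa [MonoidAlgebra.coeff_single_mul_apply, MonoidAlgebra.coeff_mul_single_apply] using this.symm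

/-- The coefficients of the reduced norm of a group element `g` over the class of `g` modulo the
commutator subgroup add up to one. -/
theorem sum_coeff_reducedNorm_single {F : Type*} [Field F] [CharZero F] [Fintype G]
    [DecidableEq (Abelianization G)] (g : G) :
    ∑ x, (if Abelianization.of x = Abelianization.of g then
      (reducedNorm F (Matrix.of fun _ _ : Fin 1 => MonoidAlgebra.single g (1 : F))).coeff x
      else 0) = 1 := by
  have h := reducedNorm_mapDomain (F := F) (Abelianization.of (G := G))
    (Quotient.mk''_surjective) (Matrix.of fun _ _ : Fin 1 => MonoidAlgebra.single g (1 : F))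
  set z := reducedNorm F (Matrix.of fun _ _ : Fin 1 => MonoidAlgebra.single g (1 : F))
  have e : (Matrix.of fun _ _ : Fin 1 => MonoidAlgebra.single g (1 : F)).map
      (MonoidAlgebra.mapDomainAlgHom F F (Abelianization.of (G := G))) =
      Matrix.of fun _ _ : Fin 1 => MonoidAlgebra.single (Abelianization.of g) (1 : F) := by
    ext1 i j
    simp
  rw [e, reducedNorm_of_comm] at h
  have h2 := congrArg (fun x => x.coeff (Abelianization.of g)) h
  simp only [MonoidAlgebra.coeff_single, Finsupp.single_eq_same] at h2
  rw [h2]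
  have h3 : z = ∑ x, MonoidAlgebra.single x (z.coeff x) := by
    ext y
    simp
  conv_rhs => rw [h3]
  simp [Finsupp.single_apply]

/-- The norms of single group elements suffice: each coset of the commutator subgroup is shown to
meet the centralizer of `P`. -/
theorem sylow_le_center_of_reducedNorm_mem [Finite G] [Group.IsNilpotent G]
    (h : ∀ g : G, reducedNorm ℚ_[p] (Matrix.of fun _ _ : Fin 1 =>
      MonoidAlgebra.single g (1 : ℚ_[p])) ∈ padicGroupRing p G) (P : Sylow p G) :
    (P : Subgroup G) ≤ Subgroup.center G := by
  classical
  have := Fintype.ofFinite G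
  have key : Subgroup.centralizer (P : Set G) ⊔ commutator G = ⊤ := by
    rw [eq_top_iff]
    intro g _
    obtain ⟨y, hy⟩ := mem_padicGroupRing_iff_exists.mp (h g)
    have hsum := sum_coeff_reducedNorm_single (F := ℚ_[p]) g
    have hcen := (reducedNorm_spec (F := ℚ_[p]) (Matrix.of fun _ _ : Fin 1 =>
      MonoidAlgebra.single g (1 : ℚ_[p]))).1
    -- The coefficients of `nr(g)` cut off to the coset of `g`; a point where `f` is nonzero
    -- therefore lies in that coset.
    let f : G → ℤ_[p] := fun x =>
      if Abelianization.of x = Abelianization.of g then y.coeff x else 0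
    have hf1 : ∑ x, f x = 1 := by
      apply PadicInt.ext
      rw [PadicInt.coe_one, ← hsum, PadicInt.coe_sum]
      refine Finset.sum_congr rfl fun x _ => ?_
      rw [hy]
      by_cases hx : Abelianization.of x = Abelianization.of g <;> simp [f, hx]
    let _ : MulAction P G := MulAction.compHom G (MulAut.conj.comp (P : Subgroup G).subtype)
    have hsmul (a : P) (x : G) : a • x = a * x * (a : G)⁻¹ := rfl
    obtain ⟨x, hx, hfix⟩ := P.isPGroup'.exists_fixedPoint_of_not_dvd_sum f (fun a x => by
      have e1 : Abelianization.of (a • x) = Abelianization.of x := by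
        rw [hsmul, map_mul, map_mul, map_inv, mul_right_comm, mul_inv_cancel, one_mul]
      have e2 : y.coeff (a • x) = y.coeff x := by
        apply PadicInt.ext
        rw [← hy, ← hy, hsmul, coeff_conj_of_mem_center hcen]
      simp only [f, e1, e2]) (by
        rw [hf1]
        exact fun hd => PadicInt.prime_p.not_isUnit (isUnit_of_dvd_one hd))
    have hxg : Abelianization.of x = Abelianization.of g := by
      by_contra hne
      exact hx (if_neg hne)
    have h1 : x ∈ Subgroup.centralizer (P : Set G) := by
      intro a ha
      have := hfix ⟨a, ha⟩
      rw [hsmul] at this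
      exact mul_inv_eq_iff_eq_mul.mp this
    have h2 : x⁻¹ * g ∈ commutator G := by
      exact QuotientGroup.eq.mp hxg
    rw [← mul_inv_cancel_left x g]
    exact Subgroup.mul_mem_sup h1 h2
  have hc := eq_top_of_sup_commutator_eq_top key
  intro a ha
  refine Subgroup.mem_center_iff.mpr fun g => ?_
  have : g ∈ Subgroup.centralizer (P : Set G) := hc ▸ Subgroup.mem_top g
  exact (this a ha).symm

end PadicGroupRing

/-! ### Representations and idempotents over a valuation ring -/

section IntegralRepresentations

variable {R K : Type*} [CommRing R] [IsDomain R] [Field K] [Algebra R K]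

/-- A matrix representation of a finite group over the field of fractions of a local Bezout domain
is equivalent to a representation over the domain. -/
theorem exists_integral_representation [IsFractionRing R K] [IsLocalRing R] [IsBezout R]
    {Q : Type*} [Group Q]
    [Finite Q] {d : ℕ} (r : Q →* Matrix (Fin d) (Fin d) K) :
    ∃ (U V : Matrix (Fin d) (Fin d) K) (s : Q →* Matrix (Fin d) (Fin d) R),
      U * V = 1 ∧ V * U = 1 ∧ ∀ h, (s h).map (algebraMap R K) = U * r h * V := by
  -- A `Q`-stable lattice, spanned by the translates of the standard basis. Over a local Bezout
  -- domain it is free: torsion-free gives flat, and finite flat over a local ring gives free.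
  let L : Submodule R (Fin d → K) :=
    Submodule.span R (Set.range fun x : Q × Fin d => (r x.1).mulVec (Pi.single x.2 1))
  have hfg : L.FG := Submodule.fg_span (Set.finite_range _)
  have hstab (h : Q) : L ≤ L.comap ((Matrix.toLin' (r h)).restrictScalars R) := by
    rw [Submodule.span_le]
    rintro _ ⟨⟨h', j⟩, rfl⟩
    refine Submodule.subset_span ⟨(h * h', j), ?_⟩
    change (r (h * h')).mulVec _ = (r h).mulVec ((r h').mulVec _)
    rw [map_mul, Matrix.mulVec_mulVec]
  have hlat : Submodule.IsLattice K L := by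
    refine ⟨hfg, ?_⟩
    rw [eq_top_iff, ← (Pi.basisFun K (Fin d)).span_eq]
    refine Submodule.span_mono ?_
    rintro _ ⟨j, rfl⟩
    refine Submodule.subset_span ⟨(1, j), ?_⟩
    change (r 1).mulVec _ = _
    rw [map_one, Matrix.one_mulVec, Pi.basisFun_apply]
  have : Module.Finite R L := Module.Finite.iff_fg.mpr hfg
  have htf : Module.IsTorsionFree R (Fin d → K) := Module.IsTorsionFree.trans_faithfulSMul R K _
  have htf' : Module.IsTorsionFree R L := inferInstance
  have : Module.Flat R L := by
    rw [Module.Flat.flat_iff_torsion_eq_bot_of_isBezout,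
      ← Submodule.isTorsionFree_iff_torsion_eq_bot]
    exact htf'
  have hfree : Module.Free R L := Module.free_of_flat_of_isLocalRing
  let b₀ := Module.Free.chooseBasis R L
  have hcard : Fintype.card (Module.Free.ChooseBasisIndex R L) = Fintype.card (Fin d) := by
    rw [← Module.finrank_eq_card_basis (b₀.extendOfIsLattice K),
      ← Module.finrank_eq_card_basis (Pi.basisFun K (Fin d))]
  let b : Module.Basis (Fin d) R L := b₀.reindex (Fintype.equivOfCardEq hcard)
  let bK : Module.Basis (Fin d) K (Fin d → K) := b.extendOfIsLattice K
  have hbK (i : Fin d) : bK i = (b i : Fin d → K) := Module.Basis.extendOfIsLattice_apply ..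
  have hrepr (x : L) (i : Fin d) : bK.repr x i = algebraMap R K (b.repr x i) := by
    have hx : (x : Fin d → K) = ∑ j, algebraMap R K (b.repr x j) • bK j := by
      conv_lhs => rw [← b.sum_repr x]
      rw [Submodule.coe_sum]
      exact Finset.sum_congr rfl fun j _ => by
        rw [hbK, algebraMap_smul, Submodule.coe_smul_of_tower]
    rw [hx, Module.Basis.repr_sum_self]
  let act : Q →* Module.End R L :=
    { toFun := fun h => ((Matrix.toLin' (r h)).restrictScalars R).restrict (hstab h)
      map_one' := by ext; simp
      map_mul' := fun h h' => by ext; simp [Matrix.mulVec_mulVec] }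
  refine ⟨bK.toMatrix (Pi.basisFun K (Fin d)), (Pi.basisFun K (Fin d)).toMatrix bK,
    ((LinearMap.toMatrixAlgEquiv b).toAlgHom : _ →* _).comp act, ?_, ?_, fun h => ?_⟩
  · exact bK.toMatrix_mul_toMatrix_flip _
  · exact (Pi.basisFun K (Fin d)).toMatrix_mul_toMatrix_flip _
  · have e : r h = LinearMap.toMatrix (Pi.basisFun K (Fin d)) (Pi.basisFun K (Fin d))
        (Matrix.toLin' (r h)) := by
      rw [LinearMap.toMatrix_eq_toMatrix', LinearMap.toMatrix'_toLin']
    rw [e, basis_toMatrix_mul_linearMap_toMatrix_mul_basis_toMatrix]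
    ext i j
    rw [LinearMap.toMatrix_apply, hbK]
    refine Eq.trans ?_ (hrepr (act h (b j)) i).symm
    simp [LinearMap.toMatrixAlgEquiv_apply]

/-- Central idempotents of the group algebra of `Q` have integral coefficients, up to `|Q|`. -/
theorem isIntegral_card_mul_coeff [IsAlgClosed K] {Q : Type*} [Group Q] [Finite Q]
    {e : MonoidAlgebra K Q} (he : e * e = e) (hc : e ∈ Set.center (MonoidAlgebra K Q)) (h : Q) :
    IsIntegral R ((Nat.card Q : K) * e.coeff h) := by
  classical
  have := Fintype.ofFinite Q
  -- Left multiplication by `e h⁻¹` has trace `|Q|` times the coefficient of `e` at `h`. Since `x ^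
  -- |Q| = e`, its eigenvalues satisfy `μ ^ (|Q| + 1) = μ` and are integral.
  set x : MonoidAlgebra K Q := e * MonoidAlgebra.single h⁻¹ 1 with hx
  have hpow : x ^ (Nat.card Q + 1) = x := by
    have hcomm : Commute e (MonoidAlgebra.single h⁻¹ 1) :=
      ((Semigroup.mem_center_iff.mp hc) _).symm
    rw [hx, hcomm.mul_pow, (show IsIdempotentElem e from he).pow_succ_eq,
      MonoidAlgebra.single_pow, one_pow, pow_succ, pow_card_eq_one', one_mul]
  have htr : LinearMap.trace K _ (LinearMap.mulLeft K x) = (Nat.card Q : K) * e.coeff h := by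
    let b : Module.Basis Q K (MonoidAlgebra K Q) := ⟨MonoidAlgebra.coeffLinearEquiv K⟩
    rw [LinearMap.trace_eq_matrix_trace K b, Matrix.trace]
    have : ∀ g : Q, (LinearMap.toMatrix b b (LinearMap.mulLeft K x)).diag g = e.coeff h := by
      intro g
      have hb : b g = MonoidAlgebra.single g 1 := by
        apply b.repr.injective
        rw [b.repr_self]
        rfl
      rw [Matrix.diag_apply, LinearMap.toMatrix_apply, hb, LinearMap.mulLeft_apply]
      change (x * MonoidAlgebra.single g 1).coeff g = _
      simp [hx, MonoidAlgebra.coeff_mul_single_apply]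
    rw [Finset.sum_congr rfl fun g _ => this g, Finset.sum_const, nsmul_eq_mul,
      Nat.card_eq_fintype_card, Finset.card_univ]
  rw [← htr, Module.End.trace_eq_sum_roots_charpoly_of_splits (IsAlgClosed.splits _)]
  refine IsIntegral.multiset_sum fun μ hμ => ?_
  have hev : Module.End.HasEigenvalue (LinearMap.mulLeft K x) μ :=
    (Module.End.hasEigenvalue_iff_isRoot_charpoly _ μ).mpr (Polynomial.isRoot_of_mem_roots hμ)
  obtain ⟨v, hv⟩ := hev.exists_hasEigenvector
  have h1 : (LinearMap.mulLeft K x ^ (Nat.card Q + 1)) v = μ ^ (Nat.card Q + 1) • v :=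
    hv.pow_apply _
  rw [LinearMap.pow_mulLeft, hpow, hv.apply_eq_smul] at h1
  have h2 : μ = μ ^ (Nat.card Q + 1) := smul_left_injective K hv.2 h1
  refine ⟨Polynomial.X ^ (Nat.card Q + 1) - Polynomial.X, ?_, ?_⟩
  · exact Polynomial.monic_X_pow_sub (by
      rw [Polynomial.degree_X]
      exact_mod_cast Nat.lt_add_of_pos_left Nat.card_pos)
  · rw [Polynomial.eval₂_sub, Polynomial.eval₂_pow, Polynomial.eval₂_X, ← h2, sub_self]

/-- Conjugation by an invertible matrix. -/
def conjAlgEquivOfMulEqOne {K : Type*} [Field K] {d : ℕ} (U V : Matrix (Fin d) (Fin d) K)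
    (hUV : U * V = 1) (hVU : V * U = 1) :
    Matrix (Fin d) (Fin d) K ≃ₐ[K] Matrix (Fin d) (Fin d) K where
  toFun X := V * X * U
  invFun X := U * X * V
  left_inv X := by
    change U * (V * X * U) * V = X
    rw [← mul_assoc, ← mul_assoc, hUV, one_mul, mul_assoc, hUV, mul_one]
  right_inv X := by
    change V * (U * X * V) * U = X
    rw [← mul_assoc, ← mul_assoc, hVU, one_mul, mul_assoc, hVU, mul_one]
  map_mul' X Y := by
    simp only [mul_assoc]
    rw [← mul_assoc U V, hUV, one_mul]
  map_add' X Y := by rw [mul_add, add_mul]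
  commutes' c := by
    rw [← Algebra.commutes, mul_assoc, hVU, mul_one]

/-- The Wedderburn decomposition of `K[Q]` over `R` if the order of `Q` is invertible in `R`:
the irreducible representations and the central idempotents are defined over `R`. -/
theorem exists_integral_wedderburn [IsFractionRing R K] [IsLocalRing R] [IsBezout R]
    [IsIntegrallyClosed R]
    [IsAlgClosed K] [CharZero K] {Q : Type*} [Group Q] [Finite Q]
    (hQ : IsUnit (Nat.card Q : R)) :
    ∃ (k : ℕ) (m : Fin k → ℕ) (r : ∀ i, Q →* Matrix (Fin (m i)) (Fin (m i)) R)
      (e : Fin k → MonoidAlgebra R Q),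
      ∀ (d : ℕ) (_ : d ≠ 0) (τ : MonoidAlgebra K Q →ₐ[K] Matrix (Fin d) (Fin d) K),
        Function.Surjective τ →
        ∃ (i : Fin k) (ψ : Matrix (Fin (m i)) (Fin (m i)) K ≃ₐ[K] Matrix (Fin d) (Fin d) K),
          (∀ h, τ (MonoidAlgebra.single h 1) = ψ ((r i h).map (algebraMap R K))) ∧
          ∀ j, τ (MonoidAlgebra.mapRingHom Q (algebraMap R K) (e j)) = if j = i then 1 else 0 := by
  obtain ⟨k, m, hm, ⟨Φ⟩⟩ :=
    IsSemisimpleRing.exists_algEquiv_pi_matrix_of_isAlgClosed K (MonoidAlgebra K Q)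
  choose U V s hUV hVU hs using fun i : Fin k => exists_integral_representation (R := R)
    (((Pi.evalAlgHom K (fun i => Matrix (Fin (m i)) (Fin (m i)) K) i).comp
      (Φ : MonoidAlgebra K Q →ₐ[K] _)).toMonoidHom.comp (MonoidAlgebra.of K Q))
  have hidem (j : Fin k) : Φ.symm (Pi.single j 1) * Φ.symm (Pi.single j 1) =
      Φ.symm (Pi.single j 1) := by
    rw [← map_mul, ← Pi.single_mul, one_mul]
  have hcen (j : Fin k) : Φ.symm (Pi.single j 1) ∈ Set.center (MonoidAlgebra K Q) := by
    rw [Semigroup.mem_center_iff]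
    intro b
    apply Φ.injective
    rw [map_mul, map_mul, Φ.apply_symm_apply]
    ext1 i
    by_cases h : i = j
    · subst h; simp
    · simp [h]
  -- Here the invertibility of `|Q|` removes the factor `|Q|` from the integrality statement.
  have hcoeff (j : Fin k) (h : Q) :
      ∃ c : R, algebraMap R K c = (Φ.symm (Pi.single j 1)).coeff h := by
    obtain ⟨u, hu⟩ := hQ
    obtain ⟨c, hc⟩ := IsIntegrallyClosed.isIntegral_iff.mp
      (isIntegral_card_mul_coeff (R := R) (hidem j) (hcen j) h)
    refine ⟨(u⁻¹ : Rˣ) * c, ?_⟩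
    rw [map_mul, hc, ← mul_assoc, ← map_natCast (algebraMap R K), ← hu, ← map_mul, Units.inv_mul,
      map_one, one_mul]
  choose c hc using hcoeff
  have he (j : Fin k) : MonoidAlgebra.mapRingHom Q (algebraMap R K)
      (.ofCoeff (Finsupp.equivFunOnFinite.symm (c j))) = Φ.symm (Pi.single j 1) := by
    ext h
    simp [MonoidAlgebra.mapRingHom, hc]
  refine ⟨k, m, s, fun j => .ofCoeff (Finsupp.equivFunOnFinite.symm (c j)), fun d hd τ hτ => ?_⟩
  obtain ⟨i, ψ, h⟩ := exists_component_of_surjective hm Φ hd τ hτ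
  refine ⟨i, (conjAlgEquivOfMulEqOne (U i) (V i) (hUV i) (hVU i)).trans ψ, fun g => ?_, fun j => ?_⟩
  · rw [AlgEquiv.trans_apply, hs, h]
    congr 1
    exact ((conjAlgEquivOfMulEqOne (U i) (V i) (hUV i) (hVU i)).apply_symm_apply _).symm
  · rw [he, h, Φ.apply_symm_apply]
    by_cases hij : j = i
    · subst hij; simp
    · simp [hij]

end IntegralRepresentations

/-! ### Determinants for a product with a commutative group -/

section ProductOfGroups

variable {R K : Type*} [CommRing R] [Field K] [Algebra R K]

theorem mapRingHom_smul {A : Type*} [Group A] (t : R) (x : MonoidAlgebra R A) :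
    MonoidAlgebra.mapRingHom A (algebraMap R K) (t • x) =
      algebraMap R K t • MonoidAlgebra.mapRingHom A (algebraMap R K) x := by
  ext g
  simp only [MonoidAlgebra.mapRingHom, RingHom.coe_mk, MonoidHom.coe_mk, OneHom.coe_mk,
    MonoidAlgebra.coeff_map, MonoidAlgebra.coeff_smul, Finsupp.smul_apply, smul_eq_mul]
  exact map_mul (algebraMap R K) _ _

theorem mapRingHom_mapDomainRingHom {A B : Type*} [Group A] [Group B] (f : A →* B)
    (x : MonoidAlgebra R A) :
    MonoidAlgebra.mapRingHom B (algebraMap R K) (MonoidAlgebra.mapDomainRingHom R f x) =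
      MonoidAlgebra.mapDomainAlgHom K K f (MonoidAlgebra.mapRingHom A (algebraMap R K) x) := by
  have : (MonoidAlgebra.mapRingHom B (algebraMap R K)).comp (MonoidAlgebra.mapDomainRingHom R f) =
      ((MonoidAlgebra.mapDomainAlgHom K K f : MonoidAlgebra K A →ₐ[K] MonoidAlgebra K B) :
        _ →+* _).comp (MonoidAlgebra.mapRingHom A (algebraMap R K)) := by
    apply MonoidAlgebra.ringHom_ext
    · intro r; simp [MonoidAlgebra.mapRingHom]
    · intro a; simp [MonoidAlgebra.mapRingHom]
  exact congrArg (fun f => f x) this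

/-- Let `G = Q × P` with `P` commutative and with the order of `Q` invertible in `R`. For every
matrix `H` over `R[G]` the determinants of the images of `H` under the irreducible representations
come from an element of `R[G]`. -/
theorem exists_integral_blockDet_lift [IsDomain R] [IsFractionRing R K] [IsLocalRing R]
    [IsBezout R] [IsIntegrallyClosed R] [IsAlgClosed K] [CharZero K] {G Q P : Type*}
    [Group G] [Group Q] [Finite Q] [CommGroup P]
    (e : G ≃* Q × P) (hQ : IsUnit (Nat.card Q : R)) {n : ℕ}
    (H : Matrix (Fin n) (Fin n) (MonoidAlgebra R G)) :
    ∃ w : MonoidAlgebra R G, ∀ (d : ℕ) (τ : MonoidAlgebra K G →ₐ[K] Matrix (Fin d) (Fin d) K),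
      Function.Surjective τ → τ (MonoidAlgebra.mapRingHom G (algebraMap R K) w) =
        Matrix.scalar (Fin d)
          (blockDet ((H.map (MonoidAlgebra.mapRingHom G (algebraMap R K))).map τ)) := by
  obtain ⟨k, m, r, ε, hε⟩ := exists_integral_wedderburn (R := R) (K := K) hQ
  let inQ : Q →* G := (e.symm : Q × P →* G).comp (MonoidHom.inl Q P)
  let inP : P →* G := (e.symm : Q × P →* G).comp (MonoidHom.inr Q P)
  have hdec (g : G) : g = inQ (e g).1 * inP (e g).2 := by
    apply e.injective
    simp [inQ, inP]
  have hcomm (a : P) (g : G) : g * inP a = inP a * g := by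
    apply e.injective
    rw [map_mul, map_mul]
    ext1
    · simp [inP]
    · simp [inP, mul_comm]
  -- The `i`-th representation of `Q` with `P` kept generic: `(a, b) ↦ b • r i a`.
  let σ (i : Fin k) : MonoidAlgebra R G →ₐ[R] Matrix (Fin (m i)) (Fin (m i)) (MonoidAlgebra R P) :=
    MonoidAlgebra.lift R _ G
      { toFun := fun g => (MonoidAlgebra.single (e g).2 1 : MonoidAlgebra R P) •
          (r i (e g).1).map (algebraMap R (MonoidAlgebra R P))
        map_one' := by
          simp [Matrix.map_one, ← MonoidAlgebra.one_def]
        map_mul' := fun g h => by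
          rw [smul_mul_smul_comm, ← Matrix.map_mul, ← map_mul, MonoidAlgebra.single_mul_single,
            map_mul e, mul_one]
          rfl }
  refine ⟨∑ j, MonoidAlgebra.mapDomainRingHom R inP (blockDet (H.map (σ j))) *
    MonoidAlgebra.mapDomainRingHom R inQ (ε j), fun d τ hτ => ?_⟩
  rcases eq_or_ne d 0 with rfl | hd
  · exact Subsingleton.elim _ _
  have : NeZero d := ⟨hd⟩
  -- Schur's lemma: `P` is central in `G`, so it acts through a character `c`, which extends to `Λ`
  -- below.
  have hscal (a : P) : ∃ c : K, Matrix.scalar (Fin d) c = τ (MonoidAlgebra.single (inP a) 1) := by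
    have h1 : τ (MonoidAlgebra.single (inP a) 1) ∈ Set.center (Matrix (Fin d) (Fin d) K) := by
      rw [Semigroup.mem_center_iff]
      intro M
      obtain ⟨x, rfl⟩ := hτ M
      rw [← map_mul, ← map_mul]
      congr 1
      induction x using MonoidAlgebra.induction_on with
      | of g => simp [MonoidAlgebra.single_mul_single, hcomm]
      | add x y hx hy => rw [add_mul, mul_add, hx, hy]
      | smul r x hx => rw [smul_mul_assoc, mul_smul_comm, hx]
    rwa [Matrix.center_eq_range] at h1
  choose c hc using hscal
  let Λ : MonoidAlgebra R P →ₐ[R] K := MonoidAlgebra.lift R K P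
    { toFun := c
      map_one' := by
        apply (Matrix.scalar_inj (n := Fin d)).mp
        rw [hc, map_one inP, ← MonoidAlgebra.one_def, map_one, map_one]
      map_mul' := fun a b => by
        apply (Matrix.scalar_inj (n := Fin d)).mp
        rw [map_mul, hc, hc, hc, map_mul inP, ← map_mul τ, MonoidAlgebra.single_mul_single, mul_one] }
  have hΛ (s : MonoidAlgebra R P) : τ (MonoidAlgebra.mapRingHom G (algebraMap R K)
      (MonoidAlgebra.mapDomainRingHom R inP s)) = Matrix.scalar (Fin d) (Λ s) := by
    rw [mapRingHom_mapDomainRingHom]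
    induction s using MonoidAlgebra.induction_on with
    | of a => simp [Λ, MonoidAlgebra.mapRingHom, ← hc]
    | add x y hx hy => simp only [map_add, hx, hy]
    | smul t x hx =>
      rw [mapRingHom_smul, map_smul, map_smul, hx, map_smul, Algebra.smul_def t, map_mul,
        Algebra.smul_def (algebraMap R K t)]
      rfl
  have hsingle (g : G) : τ (MonoidAlgebra.single g 1) =
      c (e g).2 • τ (MonoidAlgebra.single (inQ (e g).1) 1) := by
    conv_lhs => rw [hdec g]
    rw [← one_mul (1 : K), ← MonoidAlgebra.single_mul_single, map_mul, ← hc, one_mul,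
      Matrix.scalar_apply, ← Matrix.smul_one_eq_diagonal, mul_smul_comm, mul_one]
  let τQ : MonoidAlgebra K Q →ₐ[K] Matrix (Fin d) (Fin d) K :=
    τ.comp (MonoidAlgebra.mapDomainAlgHom K K inQ)
  have hτQ (a : Q) : τQ (MonoidAlgebra.single a 1) = τ (MonoidAlgebra.single (inQ a) 1) := by
    simp [τQ]
  -- Since `P` acts by scalars, the images of `Q` already span, so `τQ` is one of the irreducible
  -- representations of `Q`.
  have hsurj : Function.Surjective τQ := by
    intro M
    obtain ⟨x, rfl⟩ := hτ M
    induction x using MonoidAlgebra.induction_on with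
    | of g => exact ⟨c (e g).2 • MonoidAlgebra.single (e g).1 1, by
        rw [map_smul, hτQ]; exact (hsingle g).symm⟩
    | add x y hx hy =>
      obtain ⟨x', hx⟩ := hx
      obtain ⟨y', hy⟩ := hy
      exact ⟨x' + y', by rw [map_add, hx, hy, map_add]⟩
    | smul t x hx =>
      obtain ⟨x', hx⟩ := hx
      exact ⟨t • x', by rw [map_smul, hx, map_smul]⟩
  obtain ⟨i, ψ, hψ, hidem⟩ := hε d hd τQ hsurj
  have hσ (x : MonoidAlgebra R G) : τ (MonoidAlgebra.mapRingHom G (algebraMap R K) x) =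
      ψ ((σ i x).map Λ) := by
    induction x using MonoidAlgebra.induction_on with
    | of g =>
      have e1 : (σ i (MonoidAlgebra.of R G g)).map Λ =
          c (e g).2 • (r i (e g).1).map (algebraMap R K) := by
        ext a b
        simp only [σ, Λ, MonoidAlgebra.lift_of, MonoidHom.coe_mk, OneHom.coe_mk, Matrix.map_apply,
          Matrix.smul_apply, smul_eq_mul, map_mul, AlgHom.commutes]
        simp
      rw [e1, map_smul, ← hψ, hτQ, ← hsingle]
      simp [MonoidAlgebra.mapRingHom]
    | add x y hx hy =>
      rw [map_add, map_add, hx, hy, map_add, Matrix.map_add _ (map_add Λ), map_add]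
    | smul t x hx =>
      have e2 : (σ i (t • x)).map Λ = algebraMap R K t • (σ i x).map Λ := by
        ext a b
        rw [map_smul, Matrix.map_apply, Matrix.smul_apply, map_smul, Algebra.smul_def]
        rfl
      rw [mapRingHom_smul, e2, map_smul, hx, map_smul]
  have hterm (j : Fin k) : τ (MonoidAlgebra.mapRingHom G (algebraMap R K)
      (MonoidAlgebra.mapDomainRingHom R inQ (ε j))) = if j = i then 1 else 0 := by
    rw [mapRingHom_mapDomainRingHom, ← hidem j]
    rfl
  -- Only the idempotent with `j = i` survives under `τ`, leaving `Λ (det (σ i H))`.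
  simp only [map_sum, map_mul, hΛ, hterm, mul_ite, mul_one, mul_zero, Finset.sum_ite_eq',
    Finset.mem_univ, if_true]
  congr 1
  have e3 : (H.map (MonoidAlgebra.mapRingHom G (algebraMap R K))).map τ =
      (((H.map (σ i)).map fun M => M.map (Λ : MonoidAlgebra R P →+* K)).map ψ) := by
    ext1 a b
    exact hσ _
  rw [e3, blockDet_algEquiv, blockDet_map]
  rfl

end ProductOfGroups

/-- The lift `w` over `R` and the reduced norm agree under all surjections, so the coefficients of
the norm lie in `R ∩ ℚ_[p]`. -/
theorem reducedNorm_mem_padicGroupRing_of_mulEquiv {p : ℕ} [Fact p.Prime] {G Q P : Type*} [Group G]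
    [Finite G] [Group Q] [Finite Q] [CommGroup P] (e : G ≃* Q × P) (hQ : ¬ p ∣ Nat.card Q) {n : ℕ}
    (H : Matrix (Fin n) (Fin n) (padicGroupRing p G)) :
    reducedNorm ℚ_[p] (H.map (padicGroupRing p G).val) ∈ padicGroupRing p G := by
  obtain ⟨R, hR, hloc⟩ := IsLocalRing.exists_factor_valuationRing
    ((algebraMap ℚ_[p] (AlgebraicClosure ℚ_[p])).comp (algebraMap ℤ_[p] ℚ_[p]))
  set f : ℤ_[p] →+* R := ((algebraMap ℚ_[p] (AlgebraicClosure ℚ_[p])).comp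
    (algebraMap ℤ_[p] ℚ_[p])).codRestrict R.toSubring hR with hf
  have hf' (x : ℤ_[p]) : (f x : AlgebraicClosure ℚ_[p]) =
      algebraMap ℚ_[p] (AlgebraicClosure ℚ_[p]) x := rfl
  have hunit : IsUnit (Nat.card Q : R) := by
    have h1 : IsUnit (Nat.card Q : ℤ_[p]) := by
      rw [PadicInt.isUnit_iff]
      exact PadicInt.norm_natCast_eq_one_iff.mpr
        ((Nat.Prime.coprime_iff_not_dvd Fact.out).mpr hQ)
    have := h1.map f
    rwa [map_natCast] at this
  -- If `‖x‖ > 1`, then `x⁻¹` is a nonunit of `ℤ_[p]` that becomes a unit in `R`, contradicting that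
  -- `R` dominates `ℤ_[p]`.
  have hint (x : ℚ_[p]) (hx : algebraMap ℚ_[p] (AlgebraicClosure ℚ_[p]) x ∈ R) : ‖x‖ ≤ 1 := by
    by_contra! hlt
    have hx0 : x ≠ 0 := by
      rintro rfl
      simp at hlt
      linarith
    have hinv : ‖x⁻¹‖ < 1 := by
      rw [norm_inv]
      exact inv_lt_one_of_one_lt₀ hlt
    let y : ℤ_[p] := ⟨x⁻¹, hinv.le⟩
    have hy : IsUnit (f y) := by
      refine IsUnit.of_mul_eq_one ⟨_, hx⟩ (Subtype.ext ?_)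
      change algebraMap ℚ_[p] (AlgebraicClosure ℚ_[p]) x⁻¹ *
        algebraMap ℚ_[p] (AlgebraicClosure ℚ_[p]) x = 1
      rw [← map_mul, inv_mul_cancel₀ hx0, map_one]
    have := PadicInt.isUnit_iff.mp (hloc.map_nonunit y hy)
    exact hinv.ne this
  choose Y hY using fun i j => mem_padicGroupRing_iff_exists.mp (H i j).2
  obtain ⟨w, hw⟩ := exists_integral_blockDet_lift (R := R) (K := AlgebraicClosure ℚ_[p]) e hunit
    (Matrix.of fun i j => MonoidAlgebra.mapRingHom G f (Y i j))
  have hspec := (isReducedNorm_iff _ _).mp (reducedNorm_spec (F := ℚ_[p])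
    (H.map (padicGroupRing p G).val))
  have hH : (Matrix.of fun i j => MonoidAlgebra.mapRingHom G f (Y i j)).map
      (MonoidAlgebra.mapRingHom G (algebraMap R (AlgebraicClosure ℚ_[p]))) =
      (H.map (padicGroupRing p G).val).map (extendScalars ℚ_[p] G) := by
    ext i j g
    have := hY i j g
    simp only [Matrix.map_apply, Matrix.of_apply, MonoidAlgebra.coeff_mapAlgHom]
    change _ = algebraMap ℚ_[p] (AlgebraicClosure ℚ_[p]) ((H i j : MonoidAlgebra ℚ_[p] G).coeff g)
    rw [this]
    simp [MonoidAlgebra.mapRingHom]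
    rfl
  have heq : MonoidAlgebra.mapRingHom G (algebraMap R (AlgebraicClosure ℚ_[p])) w =
      extendScalars ℚ_[p] G (reducedNorm ℚ_[p] (H.map (padicGroupRing p G).val)) := by
    refine eq_of_forall_surjective (K := AlgebraicClosure ℚ_[p]) fun d τ hτ => ?_
    rw [hw d τ hτ, hspec.2 d τ hτ, hH]
  refine mem_padicGroupRing_of_norm_le fun g => hint _ ?_
  have h1 := congrArg (fun x => x.coeff g) heq
  simp only [MonoidAlgebra.coeff_mapAlgHom] at h1
  have h2 : algebraMap ℚ_[p] (AlgebraicClosure ℚ_[p])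
      ((reducedNorm ℚ_[p] (H.map (padicGroupRing p G).val)).coeff g) = (w.coeff g : R) := by
    refine h1.symm.trans ?_
    simp [MonoidAlgebra.mapRingHom]
  rw [h2]
  exact (w.coeff g).2

theorem mainTheorem10 (G : Type*) [Group G] [Finite G] [Group.IsNilpotent G]
    (p : ℕ) [Fact p.Prime] :
    (integralityRing ℚ_[p] (padicGroupRing p G) : Set (MonoidAlgebra ℚ_[p] G)) =
        (orderCenter (padicGroupRing p G) : Set (MonoidAlgebra ℚ_[p] G)) ↔
      ¬ p ∣ Nat.card (commutator G) := by
  rw [integralityRing_eq_orderCenter_iff]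
  constructor
  · intro h
    refine (default : Sylow p G).not_dvd_card_commutator
      (sylow_le_center_of_reducedNorm_mem (fun g => ?_) _)
    exact h 1 le_rfl (Matrix.of fun _ _ => ⟨MonoidAlgebra.single g 1, single_mem_padicGroupRing g⟩)
  · intro h n _ H
    obtain ⟨Q, P, hQ, hP, ⟨e⟩⟩ := exists_mulEquiv_prod_of_not_dvd h
    let _ : CommGroup P := { (inferInstance : Group P) with mul_comm := hP }
    exact reducedNorm_mem_padicGroupRing_of_mulEquiv e hQ H
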